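/- Let $Q_8=\{\pm1,\pm i,\pm j,\pm k\}$ be the quaternion group and let $1\to Q_8\to G'\xrightarrow{q} G\to 1$ be a short exact sequence of groups. Let $d\ge 2$ and let $\alpha_i,\beta_i\in G$, $1\le i\le d$, be such that $\prod_{i=1}^d[\alpha_i,\beta_i]=1$ (ordered product, $[x,y]=xyx^{-1}y^{-1}$). Then there is a family $\{a_i,b_i\}_{i=1}^d$ of elements of $G'$ such that $q(a_i)=\alpha_i$ and $q(b_i)=\beta_i$ for all $i$ and $\prod_{i=1}^d[a_i,b_i]=1$. The number of such families is finite and is equal to $8^{2d-1}(N+2^{2-2d})$ or to $8^{2d-1}(N-2^{2-2d})$ for some $N\in\{1,2,4\}$. -/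

import Mathlib

/-- The ordered product `[a₁, b₁] [a₂, b₂] ⋯ [a_d, b_d]` of commutators in a group,
where `[x, y] = x y x⁻¹ y⁻¹`. -/
def commutatorProd {H : Type*} [Group H] {d : ℕ} (a b : Fin d → H) : H :=
  (List.ofFn fun i => a i * b i * (a i)⁻¹ * (b i)⁻¹).prod

/-- The families `(aᵢ, bᵢ)` in `H` lifting `(αᵢ, βᵢ)` along `q`, whose ordered product of
commutators is trivial. -/
def commutatorLifts {H K : Type*} [Group H] [Group K] (q : H →* K) {d : ℕ}
    (α β : Fin d → K) : Set ((Fin d → H) × (Fin d → H)) :=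
  {p | (∀ i, q (p.1 i) = α i) ∧ (∀ i, q (p.2 i) = β i) ∧ commutatorProd p.1 p.2 = 1}

/-!
Fix lifts `A i`, `B i` of `α i`, `β i`, and let `P ∈ Q₈` be their product of commutators. Every
other lift is of the form `x i * A i`, `y i * B i` with `x i`, `y i` in `Q₈`, and replacing `A`, `B`
by it multiplies the product of commutators by some `w(x, y) ∈ Q₈` that only depends on the action
of the `A i`, `B i` on `Q₈`. The solutions of `w(x, y) * P = 1` are to be counted.

Modulo `{1, -1}`, `w` is a homomorphism to the Klein four-group, so `w(x, y) * P ∈ {1, -1}` has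
`64 ^ d * N / 4` solutions with `N ∈ {1, 2, 4}`, if it has any. To tell `1` from `-1`, embed `Q₈`
in the quaternions. There each automorphism of `Q₈` is conjugation by some unit, so the actions of
`A i`, `B i` are induced by units `u i`, `v i`, whose product of commutators `c` is `P` or `-P`
because `P⁻¹ * c` commutes with `Q₈` and has norm one. By orthogonality, the sum of
`w(x, y) * c = ∏ [x i * u i, y i * v i]` over all `x`, `y` is `16 ^ d`. Thus `w(x, y) * P` takes the
values `1` and `-1` with multiplicities that differ by `16 ^ d`, and in particular it does take one
of them.
-/

open Finset QuaternionGroup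
open scoped Quaternion

section CommutatorProd

variable {H K : Type*} [Group H] [Group K] {d : ℕ}

theorem commutatorProd_succ (a b : Fin (d + 1) → H) :
    commutatorProd a b = a 0 * b 0 * (a 0)⁻¹ * (b 0)⁻¹ *
      commutatorProd (fun i => a i.succ) fun i => b i.succ := by
  simp [commutatorProd, List.ofFn_succ]

theorem map_commutatorProd (f : H →* K) (a b : Fin d → H) :
    f (commutatorProd a b) = commutatorProd (fun i => f (a i)) fun i => f (b i) := by
  simp [commutatorProd, map_list_prod, List.map_ofFn, Function.comp_def]

theorem commutatorProd_mem (L : Subgroup H) {a b : Fin d → H} (ha : ∀ i, a i ∈ L)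
    (hb : ∀ i, b i ∈ L) : commutatorProd a b ∈ L := by
  refine L.list_prod_mem fun x hx => ?_
  obtain ⟨i, rfl⟩ := (List.mem_ofFn' _ _).1 hx
  exact L.mul_mem (L.mul_mem (L.mul_mem (ha i) (hb i)) (L.inv_mem (ha i))) (L.inv_mem (hb i))

theorem commutatorProd_eq_one {V : Type*} [CommGroup V] (a b : Fin d → V) :
    commutatorProd a b = 1 := by
  simp [commutatorProd, mul_inv_cancel_comm]

theorem val_commutatorProd {R : Type*} [Monoid R] (u v : Fin d → Rˣ) :
    (↑(commutatorProd u v) : R) =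
      (List.ofFn fun i => (↑(u i * v i * (u i)⁻¹ * (v i)⁻¹) : R)).prod := by
  rw [commutatorProd, ← Units.coeHom_apply, map_list_prod, List.map_ofFn]
  rfl

end CommutatorProd

section TwistedCommutatorProd

variable {Q H : Type*} [Group Q] [Group H] {d : ℕ}

/-- The factor by which the ordered product of commutators of `u`, `v` changes when these families
are multiplied from the left by families `x`, `y` in a subgroup `Q` on which `u i` and `v i` act by
conjugation as `σ i` and `τ i`. It is computed in the holomorph of `Q`, so that it depends on `u`
and `v` only through `σ` and `τ`. -/
def twistedCommutatorProd (σ τ : Fin d → MulAut Q) (x y : Fin d → Q) : Q :=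
  (commutatorProd (fun i => (⟨x i, σ i⟩ : Q ⋊[MonoidHom.id (MulAut Q)] MulAut Q))
    fun i => ⟨y i, τ i⟩).left

theorem twistedCommutatorProd_zero (σ τ : Fin 0 → MulAut Q) (x y : Fin 0 → Q) :
    twistedCommutatorProd σ τ x y = 1 := by
  simp [twistedCommutatorProd, commutatorProd]

theorem twistedCommutatorProd_succ (σ τ : Fin (d + 1) → MulAut Q) (x y : Fin (d + 1) → Q) :
    twistedCommutatorProd σ τ x y =
      x 0 * σ 0 (y 0) * (σ 0 * τ 0 * (σ 0)⁻¹) (x 0)⁻¹ *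
        (σ 0 * τ 0 * (σ 0)⁻¹ * (τ 0)⁻¹) ((y 0)⁻¹ *
          twistedCommutatorProd (fun i => σ i.succ) (fun i => τ i.succ) (fun i => x i.succ)
            fun i => y i.succ) := by
  simp [twistedCommutatorProd, commutatorProd_succ, mul_assoc]

/-- The pairs `(σ, u)` such that `σ` becomes conjugation by `u` under the homomorphism `f`. -/
def conjugationPairs (f : Q →* H) : Subgroup (MulAut Q × H) where
  carrier := {p | ∀ g, f (p.1 g) = p.2 * f g * p.2⁻¹}
  one_mem' g := by simp
  mul_mem' {p r} hp hr g := by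
    rw [Prod.fst_mul, Prod.snd_mul, MulAut.mul_apply, hp, hr]
    group
  inv_mem' {p} hp g := by
    have h := hp (p.1⁻¹ g)
    rw [MulAut.apply_inv_self] at h
    rw [Prod.fst_inv, Prod.snd_inv, h]
    group

theorem mem_conjugationPairs {f : Q →* H} {σ : MulAut Q} {u : H} :
    (σ, u) ∈ conjugationPairs f ↔ ∀ g, f (σ g) = u * f g * u⁻¹ :=
  Iff.rfl

variable {f : Q →* H} {σ τ : Fin d → MulAut Q} {u v : Fin d → H}

theorem commutatorProd_mem_conjugationPairs (hu : ∀ i, (σ i, u i) ∈ conjugationPairs f)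
    (hv : ∀ i, (τ i, v i) ∈ conjugationPairs f) :
    (commutatorProd σ τ, commutatorProd u v) ∈ conjugationPairs f := by
  have h := commutatorProd_mem _ hu hv
  rwa [← Prod.mk.eta (p := commutatorProd _ _), ← MonoidHom.coe_fst, ← MonoidHom.coe_snd,
    map_commutatorProd, map_commutatorProd] at h

theorem map_twistedCommutatorProd_mul_commutatorProd
    (hu : ∀ i, (σ i, u i) ∈ conjugationPairs f) (hv : ∀ i, (τ i, v i) ∈ conjugationPairs f)
    (x y : Fin d → Q) :
    f (twistedCommutatorProd σ τ x y) * commutatorProd u v =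
      commutatorProd (fun i => f (x i) * u i) fun i => f (y i) * v i := by
  induction d with
  | zero => simp [twistedCommutatorProd_zero, commutatorProd]
  | succ d ih =>
    have hσ := mem_conjugationPairs.1 (hu 0)
    have hconj (g : Q) : f ((σ 0 * τ 0 * (σ 0)⁻¹) g) =
        u 0 * v 0 * (u 0)⁻¹ * f g * (u 0 * v 0 * (u 0)⁻¹)⁻¹ :=
      mul_mem (mul_mem (hu 0) (hv 0)) (inv_mem (hu 0)) g
    have hcomm (g : Q) : f ((σ 0 * τ 0 * (σ 0)⁻¹ * (τ 0)⁻¹) g) =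
        u 0 * v 0 * (u 0)⁻¹ * (v 0)⁻¹ * f g * (u 0 * v 0 * (u 0)⁻¹ * (v 0)⁻¹)⁻¹ :=
      mul_mem (mul_mem (mul_mem (hu 0) (hv 0)) (inv_mem (hu 0))) (inv_mem (hv 0)) g
    rw [twistedCommutatorProd_succ, commutatorProd_succ, commutatorProd_succ,
      ← ih (fun i => hu i.succ) (fun i => hv i.succ)]
    simp only [map_mul f, map_inv f, hσ, hconj, hcomm]
    group

theorem map_twistedCommutatorProd_mul {V : Type*} [CommGroup V] (p : Q →* V)
    (σ τ : Fin d → MulAut Q) (x x' y y' : Fin d → Q) :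
    p (twistedCommutatorProd σ τ (x * x') (y * y')) =
      p (twistedCommutatorProd σ τ x y) * p (twistedCommutatorProd σ τ x' y') := by
  induction d generalizing p with
  | zero => simp [twistedCommutatorProd_zero]
  | succ d ih =>
    simp only [twistedCommutatorProd_succ]
    generalize σ 0 * τ 0 * (σ 0)⁻¹ * (τ 0)⁻¹ = κ
    generalize σ 0 * τ 0 * (σ 0)⁻¹ = ρ
    have h : p (κ (twistedCommutatorProd (fun i => σ i.succ) (fun i => τ i.succ)
        (fun i => x i.succ * x' i.succ) fun i => y i.succ * y' i.succ)) = _ :=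
      ih (p.comp κ.toMonoidHom) (fun i => σ i.succ) (fun i => τ i.succ) (fun i => x i.succ)
        (fun i => x' i.succ) (fun i => y i.succ) fun i => y' i.succ
    simp only [MonoidHom.comp_apply, MulEquiv.toMonoidHom_eq_coe, MonoidHom.coe_coe] at h
    simp only [Pi.mul_apply, map_mul, map_inv, mul_inv, h]
    generalize p (κ (twistedCommutatorProd _ _ _ _)) = t, p (κ (twistedCommutatorProd _ _ _ _)) = t'
    ac_rfl

end TwistedCommutatorProd

section Quaternion

theorem quaternion_re_mul_comm {R : Type*} [CommRing R] (x y : ℍ[R]) :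
    (x * y).re = (y * x).re := by
  simp only [Quaternion.re_mul]
  ring

theorem quaternion_re_sum {R ι : Type*} [CommRing R] (t : Finset ι) (F : ι → ℍ[R]) :
    (∑ i ∈ t, F i).re = ∑ i ∈ t, (F i).re :=
  map_sum (⟨⟨fun z => z.re, Quaternion.re_zero⟩, Quaternion.re_add⟩ : ℍ[R] →+ R) F t

theorem normSq_commutatorProd {R : Type*} [CommRing R] {d : ℕ} (u v : Fin d → ℍ[R]ˣ) :
    Quaternion.normSq (↑(commutatorProd u v) : ℍ[R]) = 1 := by
  have h := map_commutatorProd (Units.map (Quaternion.normSq (R := R) : ℍ[R] →* R)) u v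
  rw [commutatorProd_eq_one] at h
  exact congrArg Units.val h

theorem normSq_map_eq_one {Q : Type*} [Group Q] [Finite Q] (f : Q →* ℍ[ℚ]ˣ) (g : Q) :
    Quaternion.normSq (f g : ℍ[ℚ]) = 1 := by
  rw [← pow_eq_one_iff_of_nonneg Quaternion.normSq_nonneg (Nat.card_pos (α := Q)).ne',
    ← map_pow, ← Units.val_pow_eq_pow_val, ← map_pow, pow_card_eq_one', map_one, Units.val_one,
    map_one]

end Quaternion

section QuaternionRepresentation

theorem zpow_eq_zpow_of_cast_eq {H : Type*} [Group H] {m : ℕ} {x : H} (hx : x ^ m = 1) {k l : ℤ}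
    (h : (k : ZMod m) = l) : x ^ k = x ^ l := by
  rw [zpow_eq_zpow_iff_modEq]
  exact ((ZMod.intCast_eq_intCast_iff _ _ _).1 h).of_dvd
    (Int.natCast_dvd_natCast.2 (orderOf_dvd_of_pow_eq_one hx))

/-- The universal property of the generalized quaternion group of order `4 * n`: the homomorphism
to a group `H` sending `a 1` to `x` and `xa 0` to `y`. -/
def quaternionGroupLift {n : ℕ} {H : Type*} [Group H] {x y : H} (hx : x ^ (2 * n) = 1)
    (hy : y * y = x ^ n) (hxy : x * y = y * x⁻¹) : QuaternionGroup n →* H where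
  toFun
    | a k => x ^ (k.cast : ℤ)
    | xa k => y * x ^ (k.cast : ℤ)
  map_one' := by
    change x ^ ((0 : ZMod (2 * n)).cast : ℤ) = 1
    rw [ZMod.cast_zero, zpow_zero]
  map_mul' := by
    have hcomm (k : ℤ) : x ^ k * y = y * x ^ (-k) := by
      rw [zpow_neg, ← inv_zpow]
      exact (SemiconjBy.zpow_right (a := y) hxy.symm k).symm
    rintro (i | i) (j | j)
    · change x ^ ((i + j).cast : ℤ) = _
      rw [← zpow_add]
      exact zpow_eq_zpow_of_cast_eq hx (by simp)
    · change y * x ^ ((j - i).cast : ℤ) = _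
      rw [← mul_assoc, hcomm, mul_assoc, ← zpow_add]
      exact congrArg _ (zpow_eq_zpow_of_cast_eq hx (by push_cast; ring))
    · change y * x ^ ((i + j).cast : ℤ) = _
      rw [mul_assoc, ← zpow_add]
      exact congrArg _ (zpow_eq_zpow_of_cast_eq hx (by simp))
    · change x ^ ((n + j - i).cast : ℤ) = _
      rw [mul_assoc, ← mul_assoc _ y, hcomm, mul_assoc, ← mul_assoc, hy, ← zpow_add,
        ← zpow_natCast, ← zpow_add]
      exact zpow_eq_zpow_of_cast_eq hx (by push_cast; ring)

/-- The quaternion `i`. -/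
@[simps]
def basisI : ℍ[ℚ] := ⟨0, 1, 0, 0⟩

/-- The quaternion `j`. -/
@[simps]
def basisJ : ℍ[ℚ] := ⟨0, 0, 1, 0⟩

theorem basisI_mul_self : basisI * basisI = -1 := by
  ext <;> simp

theorem basisJ_mul_self : basisJ * basisJ = -1 := by
  ext <;> simp

theorem basisI_mul_basisJ : basisI * basisJ = -(basisJ * basisI) := by
  ext <;> simp

/-- The quaternion `i` as a unit. -/
def unitI : ℍ[ℚ]ˣ :=
  ⟨basisI, -basisI, by simp [basisI_mul_self], by simp [basisI_mul_self]⟩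

/-- The quaternion `j` as a unit. -/
def unitJ : ℍ[ℚ]ˣ :=
  ⟨basisJ, -basisJ, by simp [basisJ_mul_self], by simp [basisJ_mul_self]⟩

theorem unitI_sq : unitI ^ 2 = -1 :=
  Units.ext <| by simp [sq, unitI, basisI_mul_self]

/-- The embedding of `Q₈` into the units of the rational quaternions that sends `a 1` to `i` and
`xa 0` to `j`, and therefore `a 2` to `-1`. -/
def quaternionRep : QuaternionGroup 2 →* ℍ[ℚ]ˣ :=
  quaternionGroupLift (x := unitI) (y := unitJ) (by rw [pow_mul, unitI_sq, neg_one_sq])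
    (by rw [unitI_sq]; exact Units.ext basisJ_mul_self)
    (Units.ext <| by
      change basisI * basisJ = basisJ * -basisI
      rw [basisI_mul_basisJ, mul_neg])

theorem quaternionRep_values :
    quaternionRep (a 0) = 1 ∧ quaternionRep (a 1) = unitI ∧ quaternionRep (a 2) = -1 ∧
      quaternionRep (a 3) = -unitI ∧ quaternionRep (xa 0) = unitJ ∧
      quaternionRep (xa 1) = unitJ * unitI ∧ quaternionRep (xa 2) = -unitJ ∧
      quaternionRep (xa 3) = -(unitJ * unitI) := by
  have ha (k : Fin 4) : quaternionRep (a k) = unitI ^ (k : ℕ) := by fin_cases k <;> rfl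
  have hxa (k : Fin 4) : quaternionRep (xa k) = unitJ * unitI ^ (k : ℕ) := by
    fin_cases k <;> rfl
  have h3 : unitI ^ 3 = -unitI := by rw [pow_succ, unitI_sq, neg_one_mul]
  exact ⟨map_one _, (ha 1).trans (pow_one _), (ha 2).trans unitI_sq, (ha 3).trans h3,
    (hxa 0).trans (mul_one _), (hxa 1).trans (by simp), (hxa 2).trans (by simp [unitI_sq]),
    (hxa 3).trans (by simp [h3])⟩

theorem univ_quaternionGroup_two : (univ : Finset (QuaternionGroup 2)) =
    {a 0, a 1, a 2, a 3, xa 0, xa 1, xa 2, xa 3} := by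
  decide

theorem sum_quaternionRep {M : Type*} [AddCommMonoid M] (F : ℍ[ℚ]ˣ → M) :
    ∑ g, F (quaternionRep g) = (F 1 + F (-1)) + (F unitI + F (-unitI)) +
      (F unitJ + F (-unitJ)) + (F (unitJ * unitI) + F (-(unitJ * unitI))) := by
  obtain ⟨h0, h1, h2, h3, h4, h5, h6, h7⟩ := quaternionRep_values
  rw [univ_quaternionGroup_two]
  repeat rw [Finset.sum_insert (by decide)]
  rw [sum_singleton, h0, h1, h2, h3, h4, h5, h6, h7]
  abel

theorem re_quaternionRep (g : QuaternionGroup 2) : (quaternionRep g : ℍ[ℚ]).re =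
    (if g = 1 then 1 else 0) - if g = a 2 then 1 else 0 := by
  obtain ⟨h0, h1, h2, h3, h4, h5, h6, h7⟩ := quaternionRep_values
  have hg : g ∈ (univ : Finset (QuaternionGroup 2)) := mem_univ g
  simp only [univ_quaternionGroup_two, Finset.mem_insert, mem_singleton] at hg
  obtain rfl | rfl | rfl | rfl | rfl | rfl | rfl | rfl := hg
  · rw [if_pos (by decide), if_neg (by decide), h0]; simp
  · rw [if_neg (by decide), if_neg (by decide), h1]; simp [unitI]
  · rw [if_neg (by decide), if_pos rfl, h2]; simp
  · rw [if_neg (by decide), if_neg (by decide), h3]; simp [unitI]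
  · rw [if_neg (by decide), if_neg (by decide), h4]; simp [unitJ]
  · rw [if_neg (by decide), if_neg (by decide), h5]; simp [unitI, unitJ]
  · rw [if_neg (by decide), if_neg (by decide), h6]; simp [unitJ]
  · rw [if_neg (by decide), if_neg (by decide), h7]; simp [unitI, unitJ]

theorem sum_quaternionRep_conj (z : ℍ[ℚ]) :
    ∑ g, (quaternionRep g : ℍ[ℚ]) * z * ↑(quaternionRep g)⁻¹ =
      (8 * z.re) • (1 : ℍ[ℚ]) := by
  rw [sum_quaternionRep fun w => (w : ℍ[ℚ]) * z * ↑w⁻¹]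
  ext <;> simp [unitI, unitJ, Units.inv_mk] <;> ring

theorem sum_re_smul_quaternionRep (z : ℍ[ℚ]) :
    ∑ g, ((↑(quaternionRep g)⁻¹ : ℍ[ℚ]) * z).re • (quaternionRep g : ℍ[ℚ]) = (2 : ℚ) • z := by
  rw [sum_quaternionRep fun w => ((↑w⁻¹ : ℍ[ℚ]) * z).re • (w : ℍ[ℚ])]
  ext <;> simp [unitI, unitJ, Units.inv_mk] <;> ring

theorem sum_conj_quaternionRep_mul (u v : ℍ[ℚ]ˣ) :
    ∑ g, (↑(quaternionRep g * v * u * (quaternionRep g * v)⁻¹) : ℍ[ℚ]) =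
      (8 * (u : ℍ[ℚ]).re) • (1 : ℍ[ℚ]) := by
  have h (g) : (↑(quaternionRep g * v * u * (quaternionRep g * v)⁻¹) : ℍ[ℚ]) =
      quaternionRep g * (v * u * ↑v⁻¹) * ↑(quaternionRep g)⁻¹ := by
    simp only [mul_inv_rev, Units.val_mul, mul_assoc]
  rw [sum_congr rfl fun g _ => h g, sum_quaternionRep_conj, quaternion_re_mul_comm, ← mul_assoc,
    Units.inv_mul, one_mul]

theorem sum_commutator_quaternionRep_mul (u v : ℍ[ℚ]ˣ) :
    ∑ x, ∑ y, (↑(quaternionRep x * u * (quaternionRep y * v) * (quaternionRep x * u)⁻¹ *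
      (quaternionRep y * v)⁻¹) : ℍ[ℚ]) = (16 : ℚ) • (1 : ℍ[ℚ]) := by
  calc
    _ = ∑ x, (↑(quaternionRep x * u) : ℍ[ℚ]) *
        (8 * (↑(quaternionRep x * u)⁻¹ : ℍ[ℚ]).re) • (1 : ℍ[ℚ]) := by
      simp only [← sum_conj_quaternionRep_mul _ v, mul_sum, ← Units.val_mul, mul_assoc]
    _ = ∑ x, (8 : ℚ) • ((↑(quaternionRep x)⁻¹ * (↑u⁻¹ : ℍ[ℚ])).re •
        (quaternionRep x : ℍ[ℚ])) * (u : ℍ[ℚ]) := by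
      refine sum_congr rfl fun x _ => ?_
      rw [mul_inv_rev, Units.val_mul, Units.val_mul, quaternion_re_mul_comm, mul_smul_comm, mul_one,
        mul_smul, smul_mul_assoc, smul_mul_assoc]
    _ = (16 : ℚ) • (1 : ℍ[ℚ]) := by
      rw [← sum_mul, ← smul_sum, sum_re_smul_quaternionRep, smul_smul, smul_mul_assoc,
        Units.inv_mul]
      norm_num

theorem sum_pi_list_prod_ofFn {R α : Type*} [Semiring R] [Fintype α] {d : ℕ}
    (F : Fin d → α → R) :
    ∑ x : Fin d → α, (List.ofFn fun i => F i (x i)).prod =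
      (List.ofFn fun i => ∑ t, F i t).prod := by
  induction d with
  | zero => simp
  | succ d ih =>
    rw [← (Fin.consEquiv fun _ => α).sum_comp, Fintype.sum_prod_type]
    simp only [Fin.consEquiv_apply, List.ofFn_succ, List.prod_cons, Fin.cons_zero, Fin.cons_succ,
      ← mul_sum, ih, sum_mul]

theorem sum_commutatorProd_quaternionRep_mul {d : ℕ} (u v : Fin d → ℍ[ℚ]ˣ) :
    ∑ p : (Fin d → QuaternionGroup 2) × (Fin d → QuaternionGroup 2),
      ((commutatorProd (fun i => quaternionRep (p.1 i) * u i)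
        fun i => quaternionRep (p.2 i) * v i : ℍ[ℚ]ˣ) : ℍ[ℚ]) = (16 : ℚ) ^ d • (1 : ℍ[ℚ]) := by
  have h := sum_pi_list_prod_ofFn fun (i : Fin d) (g : QuaternionGroup 2 × QuaternionGroup 2) =>
    (↑(quaternionRep g.1 * u i * (quaternionRep g.2 * v i) * (quaternionRep g.1 * u i)⁻¹ *
      (quaternionRep g.2 * v i)⁻¹) : ℍ[ℚ])
  simp only [Fintype.sum_prod_type, sum_commutator_quaternionRep_mul, List.ofFn_const,
    List.prod_replicate, smul_pow, one_pow] at h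
  rw [← h, ← (Equiv.arrowProdEquivProdArrow (Fin d) (fun _ => QuaternionGroup 2)
    fun _ => QuaternionGroup 2).sum_comp]
  simp only [val_commutatorProd, Equiv.arrowProdEquivProdArrow_apply]

theorem mul_sum_mul_inv_eq_sum_mul_inv_mul {Q R : Type*} [Group Q] [Fintype Q] [Semiring R]
    (f g : Q →* Rˣ) (t : R) (y : Q) :
    f y * ∑ x, f x * t * ↑(g x)⁻¹ = (∑ x, f x * t * ↑(g x)⁻¹) * (g y : R) := by
  rw [mul_sum, sum_mul,
    ← Equiv.sum_comp (Equiv.mulLeft y) fun x => (f x : R) * t * ↑(g x)⁻¹ * (g y : R)]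
  simp [mul_assoc]

theorem quaternionRep_injective : Function.Injective quaternionRep := by
  refine (injective_iff_map_eq_one _).2 fun g hg => ?_
  by_contra h
  have hre := re_quaternionRep g
  rw [hg, if_neg h, Units.val_one, Quaternion.re_one] at hre
  split_ifs at hre <;> norm_num at hre

-- Averaging makes `∑ x, rep (φ x) * t * (rep x)⁻¹` an intertwiner for each `t`; pairing these
-- sums with `rep` shows that they cannot all vanish.
theorem exists_mem_conjugationPairs_quaternionRep (φ : MulAut (QuaternionGroup 2)) :
    ∃ u, (φ, u) ∈ conjugationPairs quaternionRep := by
  set U : ℍ[ℚ] → ℍ[ℚ] := fun t =>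
    ∑ x, (quaternionRep (φ x) : ℍ[ℚ]) * t * ↑(quaternionRep x)⁻¹ with hU
  obtain ⟨t, ht⟩ : ∃ t, U t ≠ 0 := by
    by_contra! h
    have hsum : ∑ y, U (quaternionRep y) * ↑(quaternionRep y)⁻¹ =
        (8 : ℚ) • ∑ x, (↑(quaternionRep x⁻¹) : ℍ[ℚ]).re • (quaternionRep (φ x) : ℍ[ℚ]) := by
      simp only [hU, sum_mul]
      rw [sum_comm, smul_sum]
      refine sum_congr rfl fun x _ => ?_
      rw [smul_smul, ← mul_one (quaternionRep (φ x) : ℍ[ℚ]), ← mul_smul_comm,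
        ← sum_quaternionRep_conj, mul_sum]
      simp only [map_inv, mul_assoc, mul_one]
    have hinv : (a 2 : QuaternionGroup 2)⁻¹ = a 2 := by decide
    simp only [h, zero_mul, sum_const_zero, re_quaternionRep, sub_smul, sum_sub_distrib, ite_smul,
      one_smul, zero_smul, inv_eq_iff_eq_inv, inv_one, hinv, sum_ite_eq', mem_univ, if_true] at hsum
    have heq : quaternionRep (φ 1) = quaternionRep (φ (a 2)) := by
      rw [eq_comm, smul_eq_zero_iff_right (by norm_num), sub_eq_zero] at hsum
      exact Units.ext hsum
    exact absurd (φ.injective (quaternionRep_injective heq)) (by decide)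
  refine ⟨Units.mk0 (U t) ht, mem_conjugationPairs.2 fun y => Units.ext ?_⟩
  rw [Units.val_mul, Units.val_mul, Units.eq_mul_inv_iff_mul_eq]
  exact mul_sum_mul_inv_eq_sum_mul_inv_mul (quaternionRep.comp φ.toMonoidHom) quaternionRep t y

end QuaternionRepresentation

section CountTwistedCommutatorProd

theorem eq_one_or_eq_neg_one_of_commute {c : ℍ[ℚ]ˣ} (hc : Quaternion.normSq (c : ℍ[ℚ]) = 1)
    (h : ∀ g, Commute c (quaternionRep g)) : c = 1 ∨ c = -1 := by
  have hscalar : (c : ℍ[ℚ]) = (c : ℍ[ℚ]).re • (1 : ℍ[ℚ]) := by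
    have hconj (g) : (quaternionRep g : ℍ[ℚ]) * c * ↑(quaternionRep g)⁻¹ = c := by
      rw [← Units.val_mul, ← (h g).eq, ← Units.val_mul, mul_inv_cancel_right]
    have h8 := sum_quaternionRep_conj c
    rw [sum_congr rfl fun g _ => hconj g, sum_const, card_univ, QuaternionGroup.card,
      ← Nat.cast_smul_eq_nsmul ℚ, show ((4 * 2 : ℕ) : ℚ) = 8 by norm_num, mul_smul] at h8
    exact smul_right_injective _ (show (8 : ℚ) ≠ 0 by norm_num) h8
  rw [hscalar, Quaternion.normSq_smul, map_one, mul_one, sq, mul_self_eq_one_iff] at hc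
  obtain hc | hc := hc
  · exact .inl <| Units.ext <| by rw [hscalar, hc, one_smul, Units.val_one]
  · exact .inr <| Units.ext <| by rw [hscalar, hc, neg_one_smul, Units.val_neg, Units.val_one]

variable {d : ℕ} {σ τ : Fin d → MulAut (QuaternionGroup 2)} {P : QuaternionGroup 2}

theorem sum_quaternionRep_twistedCommutatorProd_mul (h : commutatorProd σ τ = MulAut.conj P) :
    ∃ s : ℚ, (s = 1 ∨ s = -1) ∧
      ∑ p : (Fin d → QuaternionGroup 2) × (Fin d → QuaternionGroup 2),
        (quaternionRep (twistedCommutatorProd σ τ p.1 p.2 * P) : ℍ[ℚ]) =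
          (s * 16 ^ d) • (1 : ℍ[ℚ]) := by
  choose u hu using fun i => exists_mem_conjugationPairs_quaternionRep (σ i)
  choose v hv using fun i => exists_mem_conjugationPairs_quaternionRep (τ i)
  have hsum : (∑ p : (Fin d → QuaternionGroup 2) × (Fin d → QuaternionGroup 2),
      (quaternionRep (twistedCommutatorProd σ τ p.1 p.2) : ℍ[ℚ])) * ↑(commutatorProd u v) =
        (16 : ℚ) ^ d • (1 : ℍ[ℚ]) := by
    rw [← sum_commutatorProd_quaternionRep_mul u v, sum_mul]
    refine sum_congr rfl fun p _ => ?_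
    rw [← map_twistedCommutatorProd_mul_commutatorProd hu hv, Units.val_mul]
  have hsign : (quaternionRep P)⁻¹ * commutatorProd u v = 1 ∨
      (quaternionRep P)⁻¹ * commutatorProd u v = -1 := by
    refine eq_one_or_eq_neg_one_of_commute ?_ fun g => ?_
    · rw [← map_inv, Units.val_mul, map_mul, normSq_map_eq_one, normSq_commutatorProd, one_mul]
    · have hg := mem_conjugationPairs.1 (commutatorProd_mem_conjugationPairs hu hv) g
      rw [h, MulAut.conj_apply, map_mul, map_mul, map_inv] at hg
      rw [commute_iff_eq, mul_assoc, mul_inv_eq_iff_eq_mul.1 hg.symm]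
      group
  simp only [map_mul, Units.val_mul, ← sum_mul]
  rcases hsign with hP | hP
  · refine ⟨1, .inl rfl, ?_⟩
    rw [inv_mul_eq_iff_eq_mul, mul_one] at hP
    rw [← hP, hsum, one_mul]
  · refine ⟨-1, .inr rfl, ?_⟩
    rw [inv_mul_eq_iff_eq_mul, mul_neg_one, eq_comm, neg_eq_iff_eq_neg] at hP
    rw [hP, Units.val_neg, mul_neg, hsum, neg_one_mul, neg_smul]

theorem card_twistedCommutatorProd_mul_sub (h : commutatorProd σ τ = MulAut.conj P) :
    ∃ s : ℚ, (s = 1 ∨ s = -1) ∧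
      (#{p : (Fin d → _) × (Fin d → _) | twistedCommutatorProd σ τ p.1 p.2 * P = 1} : ℚ) -
        #{p : (Fin d → _) × (Fin d → _) | twistedCommutatorProd σ τ p.1 p.2 * P = a 2} =
          s * 16 ^ d := by
  obtain ⟨s, hs, hsum⟩ := sum_quaternionRep_twistedCommutatorProd_mul h
  refine ⟨s, hs, ?_⟩
  have hre := congrArg (fun z : ℍ[ℚ] => z.re) hsum
  simp only [quaternion_re_sum, re_quaternionRep, sum_sub_distrib, sum_boole] at hre
  rw [hre, Quaternion.re_smul, Quaternion.re_one, smul_eq_mul, mul_one]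

theorem card_fiber_mul_card_range {A V : Type*} [Group A] [Group V] [Fintype A] [DecidableEq V]
    (L : A →* V) {v : V} (hv : v ∈ L.range) :
    #{x | L x = v} * Nat.card L.range = Fintype.card A := by
  rw [MonoidHom.card_fiber_eq_of_mem_range L hv L.range.one_mem, ← Subgroup.index_ker,
    ← Nat.card_eq_fintype_card, ← L.ker.card_mul_index]
  congr 1
  rw [Nat.card_eq_fintype_card, Fintype.card_subtype]
  simp only [MonoidHom.mem_ker]

theorem mem_commutator_quaternionGroup_two_iff {g : QuaternionGroup 2} :
    g ∈ commutator (QuaternionGroup 2) ↔ g = 1 ∨ g = a 2 := by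
  constructor
  · have hcenter : commutator (QuaternionGroup 2) ≤ Subgroup.center _ := by
      rw [commutator_def, Subgroup.commutator_le]
      simp only [Subgroup.mem_center_iff, commutatorElement_def, Subgroup.mem_top, true_imp_iff]
      decide
    refine fun hg => (?_ : ∀ g : QuaternionGroup 2, (∀ x, x * g = g * x) → g = 1 ∨ g = a 2) g
      (Subgroup.mem_center_iff.1 (hcenter hg))
    decide
  · rintro (rfl | rfl)
    · exact one_mem _
    · exact Subgroup.commutator_mem_commutator (Subgroup.mem_top (a 1)) (Subgroup.mem_top (xa 0))

theorem card_abelianization_quaternionGroup_two :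
    Nat.card (Abelianization (QuaternionGroup 2)) = 4 := by
  have h2 : Nat.card (commutator (QuaternionGroup 2)) = 2 := by
    have hset : (commutator (QuaternionGroup 2) : Set (QuaternionGroup 2)) = {1, a 2} :=
      Set.ext fun g => mem_commutator_quaternionGroup_two_iff
    rw [← SetLike.coe_sort_coe, hset, Nat.card_coe_set_eq, Set.ncard_pair (by decide)]
  have h8 := (commutator (QuaternionGroup 2)).card_eq_card_quotient_mul_card_subgroup
  rw [h2, Nat.card_eq_fintype_card, QuaternionGroup.card] at h8
  change Nat.card (_ ⧸ _) = 4
  omega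

theorem four_mul_card_twistedCommutatorProd_mul (σ τ : Fin d → MulAut (QuaternionGroup 2))
    {x₀ y₀ : Fin d → QuaternionGroup 2}
    (h₀ : twistedCommutatorProd σ τ x₀ y₀ * P ∈ commutator (QuaternionGroup 2)) :
    ∃ N ∈ ({1, 2, 4} : Set ℕ), 4 * #{p : (Fin d → _) × (Fin d → _) |
      twistedCommutatorProd σ τ p.1 p.2 * P = 1 ∨ twistedCommutatorProd σ τ p.1 p.2 * P = a 2} =
        64 ^ d * N := by
  classical
  let L : (Fin d → QuaternionGroup 2) × (Fin d → QuaternionGroup 2) →*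
      Abelianization (QuaternionGroup 2) := MonoidHom.mk'
    (fun p => Abelianization.of (twistedCommutatorProd σ τ p.1 p.2))
    fun p p' => map_twistedCommutatorProd_mul _ σ τ p.1 p'.1 p.2 p'.2
  have hL (p) : L p = (Abelianization.of P)⁻¹ ↔ twistedCommutatorProd σ τ p.1 p.2 * P = 1 ∨
      twistedCommutatorProd σ τ p.1 p.2 * P = a 2 := by
    rw [← mem_commutator_quaternionGroup_two_iff, ← Abelianization.ker_of, MonoidHom.mem_ker,
      map_mul, ← eq_inv_iff_mul_eq_one]
    rfl
  have hfiber := card_fiber_mul_card_range L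
    ⟨(x₀, y₀), (hL _).2 (mem_commutator_quaternionGroup_two_iff.1 h₀)⟩
  simp only [hL, Fintype.card_prod, Fintype.card_pi, QuaternionGroup.card, prod_const, card_univ,
    Fintype.card_fin, ← mul_pow] at hfiber
  obtain ⟨N, hN⟩ : Nat.card L.range ∣ 4 :=
    card_abelianization_quaternionGroup_two ▸ L.range.card_subgroup_dvd_card
  refine ⟨N, ?_, ?_⟩
  · have hN4 : N ∣ 4 := Dvd.intro_left _ hN.symm
    have hmem : N ∈ Nat.divisors 4 := Nat.mem_divisors.2 ⟨hN4, by norm_num⟩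
    rw [show Nat.divisors 4 = {1, 2, 4} by decide] at hmem
    simpa using hmem
  · rw [hN, mul_right_comm, mul_comm (Nat.card _), hfiber]
    norm_num

theorem eight_zpow_mul_add_mul_two_zpow (d : ℕ) (t s : ℚ) :
    8 ^ (2 * (d : ℤ) - 1) * (t + s * 2 ^ (2 - 2 * (d : ℤ))) = 64 ^ d * t / 8 + s * 16 ^ d / 2 := by
  have h8 : (8 : ℚ) ^ (2 * (d : ℤ) - 1) = 64 ^ d / 8 := by
    rw [zpow_sub₀ (by norm_num), zpow_mul, zpow_natCast]
    norm_num
  have h2 : (2 : ℚ) ^ (2 - 2 * (d : ℤ)) = 4 / 4 ^ d := by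
    rw [zpow_sub₀ (by norm_num), zpow_mul, zpow_natCast]
    norm_num
  have h64 : (64 : ℚ) ^ d = 16 ^ d * 4 ^ d := by
    rw [← mul_pow]
    norm_num
  rw [h8, h2, h64]
  field_simp
  ring

theorem card_twistedCommutatorProd_mul_eq_one (h : commutatorProd σ τ = MulAut.conj P) :
    ∃ N ∈ ({1, 2, 4} : Set ℕ), ∃ s : ℚ, (s = 1 ∨ s = -1) ∧
      (#{p : (Fin d → _) × (Fin d → _) | twistedCommutatorProd σ τ p.1 p.2 * P = 1} : ℚ) =
        8 ^ (2 * (d : ℤ) - 1) * (N + s * 2 ^ (2 - 2 * (d : ℤ))) := by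
  obtain ⟨s, hs, hsub⟩ := card_twistedCommutatorProd_mul_sub h
  have hne : s * 16 ^ d ≠ 0 := by
    rcases hs with rfl | rfl <;> positivity
  have hadd : #{p : (Fin d → _) × (Fin d → _) | twistedCommutatorProd σ τ p.1 p.2 * P = 1 ∨
      twistedCommutatorProd σ τ p.1 p.2 * P = a 2} =
      #{p : (Fin d → _) × (Fin d → _) | twistedCommutatorProd σ τ p.1 p.2 * P = 1} +
        #{p : (Fin d → _) × (Fin d → _) | twistedCommutatorProd σ τ p.1 p.2 * P = a 2} := by
    rw [filter_or, card_union_of_disjoint]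
    exact disjoint_filter.2 fun p _ h1 h2 => absurd (h1.symm.trans h2) (by decide)
  obtain ⟨p, hp⟩ : ({p : (Fin d → _) × (Fin d → _) | twistedCommutatorProd σ τ p.1 p.2 * P = 1 ∨
      twistedCommutatorProd σ τ p.1 p.2 * P = a 2} : Finset _).Nonempty := by
    rw [← card_ne_zero]
    intro h0
    rw [h0, eq_comm, Nat.add_eq_zero_iff] at hadd
    rw [hadd.1, hadd.2, sub_self] at hsub
    exact hne hsub.symm
  obtain ⟨N, hN, hcard⟩ := four_mul_card_twistedCommutatorProd_mul (P := P) σ τ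
    (mem_commutator_quaternionGroup_two_iff.2 (mem_filter.1 hp).2)
  refine ⟨N, hN, s, hs, ?_⟩
  rw [hadd] at hcard
  qify at hcard
  rw [eight_zpow_mul_add_mul_two_zpow]
  linarith

end CountTwistedCommutatorProd

section Lifts

variable {N E G : Type*} [Group N] [Group E] [Group G] (S : GroupExtension N E G) {d : ℕ}

theorem conjAct_inl_eq_conj (n : N) : S.conjAct (S.inl n) = MulAut.conj n := by
  ext m
  refine S.inl_injective ?_
  rw [S.inl_conjAct_comm, MulAut.conj_apply, map_mul, map_mul, map_inv]

theorem exists_inl_mul_eq_of_rightHom_eq {e e' : E} (h : S.rightHom e = S.rightHom e') :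
    ∃ n, S.inl n * e' = e := by
  have hmem : e * e'⁻¹ ∈ S.inl.range := by
    rw [S.range_inl_eq_ker_rightHom, MonoidHom.mem_ker, map_mul, map_inv, h, mul_inv_cancel]
  obtain ⟨n, hn⟩ := hmem
  exact ⟨n, by rw [hn, inv_mul_cancel_right]⟩

theorem bijOn_inl_mul_commutatorLifts (A B : Fin d → E) {P : N}
    (hP : S.inl P = commutatorProd A B) :
    Set.BijOn (fun p => (fun i => S.inl (p.1 i) * A i, fun i => S.inl (p.2 i) * B i))
      {p : (Fin d → N) × (Fin d → N) | twistedCommutatorProd (fun i => S.conjAct (A i))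
        (fun i => S.conjAct (B i)) p.1 p.2 * P = 1}
      (commutatorLifts S.rightHom (fun i => S.rightHom (A i)) fun i => S.rightHom (B i)) := by
  have hprod (x y : Fin d → N) :
      commutatorProd (fun i => S.inl (x i) * A i) (fun i => S.inl (y i) * B i) =
        S.inl (twistedCommutatorProd (fun i => S.conjAct (A i)) (fun i => S.conjAct (B i)) x y *
          P) := by
    rw [map_mul, hP, map_twistedCommutatorProd_mul_commutatorProd]
    · exact fun i => mem_conjugationPairs.2 fun g => S.inl_conjAct_comm
    · exact fun i => mem_conjugationPairs.2 fun g => S.inl_conjAct_comm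
  refine ⟨fun p hp => ⟨fun i => by simp, fun i => by simp, ?_⟩, ?_, ?_⟩
  · rw [hprod, hp.out, map_one]
  · intro p _ p' _ h
    obtain ⟨h₁, h₂⟩ := Prod.ext_iff.1 h
    exact Prod.ext (funext fun i => S.inl_injective (mul_right_cancel (congrFun h₁ i)))
      (funext fun i => S.inl_injective (mul_right_cancel (congrFun h₂ i)))
  · rintro ⟨s, t⟩ ⟨hs, ht, hst⟩
    choose x hx using fun i => exists_inl_mul_eq_of_rightHom_eq S (hs i)
    choose y hy using fun i => exists_inl_mul_eq_of_rightHom_eq S (ht i)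
    obtain rfl : (fun i => S.inl (x i) * A i) = s := funext hx
    obtain rfl : (fun i => S.inl (y i) * B i) = t := funext hy
    refine ⟨(x, y), S.inl_injective ?_, rfl⟩
    rw [← hprod, map_one]
    exact hst

end Lifts

theorem finite_commutatorLifts_and_ncard_eq {E G : Type*} [Group E] [Group G]
    (S : GroupExtension (QuaternionGroup 2) E G) {d : ℕ} {α β : Fin d → G}
    (hαβ : commutatorProd α β = 1) :
    (commutatorLifts S.rightHom α β).Finite ∧
      ∃ N ∈ ({1, 2, 4} : Set ℕ), ∃ s : ℚ, (s = 1 ∨ s = -1) ∧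
        ((commutatorLifts S.rightHom α β).ncard : ℚ) =
          8 ^ (2 * (d : ℤ) - 1) * (N + s * 2 ^ (2 - 2 * (d : ℤ))) := by
  choose A hA using fun i => S.rightHom_surjective (α i)
  choose B hB using fun i => S.rightHom_surjective (β i)
  obtain rfl : (fun i => S.rightHom (A i)) = α := funext hA
  obtain rfl : (fun i => S.rightHom (B i)) = β := funext hB
  obtain ⟨P, hP⟩ : commutatorProd A B ∈ S.inl.range := by
    rwa [S.range_inl_eq_ker_rightHom, MonoidHom.mem_ker, map_commutatorProd]
  have hconj : commutatorProd (fun i => S.conjAct (A i)) (fun i => S.conjAct (B i)) =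
      MulAut.conj P := by
    rw [← map_commutatorProd, ← hP, conjAct_inl_eq_conj]
  have hbij := bijOn_inl_mul_commutatorLifts S A B hP
  obtain ⟨N, hN, s, hs, hcard⟩ := card_twistedCommutatorProd_mul_eq_one hconj
  refine ⟨hbij.finite_iff_finite.1 (Set.toFinite _), N, hN, s, hs, ?_⟩
  rw [← hcard, ← hbij.ncard_eq, ← Set.ncard_coe_finset, coe_filter_univ]

theorem theorem5 {G' G : Type*} [Group G'] [Group G]
    (S : GroupExtension (QuaternionGroup 2) G' G)
    (d : ℕ) (hd : 2 ≤ d) (α β : Fin d → G) (hαβ : commutatorProd α β = 1) :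
    (∃ a b : Fin d → G', (∀ i, S.rightHom (a i) = α i) ∧ (∀ i, S.rightHom (b i) = β i) ∧
      commutatorProd a b = 1) ∧
    (commutatorLifts S.rightHom α β).Finite ∧
    ∃ N ∈ ({1, 2, 4} : Set ℕ),
      ((commutatorLifts S.rightHom α β).ncard : ℚ) =
          8 ^ (2 * (d : ℤ) - 1) * ((N : ℚ) + 2 ^ (2 - 2 * (d : ℤ))) ∨
      ((commutatorLifts S.rightHom α β).ncard : ℚ) =
          8 ^ (2 * (d : ℤ) - 1) * ((N : ℚ) - 2 ^ (2 - 2 * (d : ℤ))) := by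
  obtain ⟨hfin, N, hN, s, hs, hcard⟩ := finite_commutatorLifts_and_ncard_eq S hαβ
  refine ⟨?_, hfin, N, hN, ?_⟩
  · have hpos : (0 : ℚ) < (commutatorLifts S.rightHom α β).ncard := by
      have hN1 : (1 : ℚ) ≤ N := by rcases hN with rfl | rfl | rfl <;> norm_num
      have hlt : (2 : ℚ) ^ (2 - 2 * (d : ℤ)) < 1 := zpow_lt_one_of_neg₀ (by norm_num) (by omega)
      have h0 : (0 : ℚ) < 2 ^ (2 - 2 * (d : ℤ)) := by positivity
      rw [hcard]
      exact mul_pos (by positivity) (by rcases hs with rfl | rfl <;> linarith)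
    obtain ⟨⟨a, b⟩, hab⟩ := Set.nonempty_of_ncard_ne_zero (Nat.cast_pos.1 hpos).ne'
    exact ⟨a, b, hab⟩
  · rcases hs with rfl | rfl
    · exact .inl (by rw [hcard, one_mul])
    · exact .inr (by rw [hcard, neg_one_mul, ← sub_eq_add_neg])
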